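/- For an integer $m$, let $p(m)$ denote the number of partitions of $m$, with $p(0)=1$ and $p(m)=0$ for $m<0$. For $n\ge 0$, let $b_6(n)$ denote the number of $6$-regular partitions of $n$, i.e. partitions of $n$ with no part divisible by $6$. For $k\ge 1$ and $n\ge 0$, let $M_k(n)$ (the Andrews–Merca function) denote the number of partitions of $n$ in which $k$ is the least positive integer that is not a part and there are more parts $>k$ than there are parts $<k$, parts being counted with multiplicity. Then, for all integers $n\ge 0$ and $k>0$, $$(-1)^{k}\left(b_6(n)-\sum_{j=-(k-1)}^{k}(-1)^j\,p\bigl(n-3j(3j-1)\bigr)\right)=\sum_{j=0}^{\lfloor n/6\rfloor} b_6(n-6j)\,M_k(j).$$ -/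

import Mathlib

/-- Euler's partition function on the integers: the number of partitions of `n`,
with the usual convention that it vanishes for negative `n`. -/
def partitionCount (n : ℤ) : ℕ :=
  if 0 ≤ n then Fintype.card (Nat.Partition n.toNat) else 0

/-- The number of `6`-regular partitions of `n`, that is, of partitions of `n` none of whose
parts is divisible by `6`. -/
def sixRegularCount (n : ℕ) : ℕ :=
  (Nat.Partition.restricted n (fun i => ¬ 6 ∣ i)).card

open Classical in
/-- The Andrews-Merca function: the number of partitions of `n` in which `k` is the least positive
integer that is not a part and there are more parts `> k` than parts `< k`
(parts counted with multiplicity). -/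
noncomputable def andrewsMerca (k n : ℕ) : ℕ :=
  (Finset.univ.filter fun π : Nat.Partition n =>
    IsLeast {m : ℕ | 0 < m ∧ m ∉ π.parts} k ∧
      (π.parts.filter fun i => i < k).card < (π.parts.filter fun i => k < i).card).card

/-! Let `P` be the partition series, `B` the 6-regular series, `M_k` the Andrews–Merca series and
`T_k` the truncated pentagonal series. Sorting parts by divisibility by 6 gives `P(X) = B(X) P(X^6)`
(`sumSeries_partsAbove_zero_eq_mul`). Substituting `X^6` in the truncated pentagonal theorem `P T_k
= 1 + (-1)^(k-1) M_k` and multiplying by `B` gives `P(X) T_k(X^6) = B(X) + (-1)^(k-1) B(X)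
M_k(X^6)`; the claim is its coefficient at `X^n`.

The truncated theorem follows by induction on `k` from a closed form for `M_k + M_(k+1)`
(`sumSeries_mexParts_add`). To get it, partitions are graded by their number of parts above the
missing one; each graded piece is a product of explicit `q`-series, and the two families combine
termwise (`smallParts_mul_largeParts_add`). Infinite sums over the grading are replaced by
congruences modulo `X ^ N`. -/

open PowerSeries

/-! ### Calculus of generating series of sets of multisets -/

/-- The generating series of a set of multisets, graded by their sums. -/
noncomputable def sumSeries (S : Set (Multiset ℕ)) : ℤ⟦X⟧ :=
  PowerSeries.mk fun n => (Nat.card {s : Multiset ℕ // s ∈ S ∧ s.sum = n} : ℤ)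

theorem coeff_sumSeries (S : Set (Multiset ℕ)) (n : ℕ) :
    coeff n (sumSeries S) = (Nat.card {s : Multiset ℕ // s ∈ S ∧ s.sum = n} : ℤ) := by
  simp [sumSeries]

/-- Zeros could be added without changing the sum, making a fibre infinite and its `Nat.card` the
default 0; hence the recurring condition `0 ∉ s`. -/
theorem finite_fiber {S : Set (Multiset ℕ)} (hS : ∀ s ∈ S, 0 ∉ s) (n : ℕ) :
    Finite {s : Multiset ℕ // s ∈ S ∧ s.sum = n} := by
  refine Finite.of_injective (β := Nat.Partition n)
    (fun s => ⟨s.1, fun {i} hi => Nat.pos_of_ne_zero fun h => hS s.1 s.2.1 (h ▸ hi), s.2.2⟩) ?_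
  intro s t h
  exact Subtype.ext (congrArg Nat.Partition.parts h)

theorem sumSeries_union {S T : Set (Multiset ℕ)} (hS : ∀ s ∈ S, 0 ∉ s) (hT : ∀ s ∈ T, 0 ∉ s)
    (h : ∀ s ∈ S, s ∉ T) : sumSeries (S ∪ T) = sumSeries S + sumSeries T := by
  ext n
  rw [map_add, coeff_sumSeries, coeff_sumSeries, coeff_sumSeries]
  have := finite_fiber hS n
  have := finite_fiber hT n
  rw [← Nat.cast_add, ← Nat.card_sum]
  classical
  congr 1
  refine Nat.card_congr ((Equiv.subtypeEquivRight fun s => ?_).trans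
    (subtypeOrEquiv (fun s => s ∈ S ∧ s.sum = n) (fun s => s ∈ T ∧ s.sum = n) ?_))
  · simp only [Set.mem_union]; tauto
  · rw [Pi.disjoint_iff]
    intro s
    rw [Prop.disjoint_iff]
    have := h s
    tauto

theorem sumSeries_image {S : Set (Multiset ℕ)} {f : Multiset ℕ → Multiset ℕ} {d : ℕ}
    (hf : Set.InjOn f S) (hd : ∀ s ∈ S, (f s).sum = s.sum + d) :
    sumSeries (f '' S) = X ^ d * sumSeries S := by
  ext n
  rw [coeff_X_pow_mul', coeff_sumSeries]
  split_ifs with h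
  · rw [coeff_sumSeries]
    congr 1
    symm
    refine Nat.card_congr (Equiv.ofBijective
      (fun s => ⟨f s.1, ⟨s.1, s.2.1, rfl⟩, by rw [hd _ s.2.1, s.2.2]; omega⟩) ⟨?_, ?_⟩)
    · intro s t hst
      exact Subtype.ext (hf s.2.1 t.2.1 (congrArg Subtype.val hst))
    · rintro ⟨_, ⟨s, hs, rfl⟩, hn⟩
      exact ⟨⟨s, hs, by rw [hd s hs] at hn; omega⟩, rfl⟩
  · have : IsEmpty {s : Multiset ℕ // s ∈ f '' S ∧ s.sum = n} := by
      refine ⟨?_⟩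
      rintro ⟨_, ⟨s, hs, rfl⟩, hn⟩
      rw [hd s hs] at hn
      omega
    rw [Nat.card_of_isEmpty, Nat.cast_zero]

/-- If membership in `U` is decided separately by the parts that satisfy `p` and by those that do
not, the generating series is a product. -/
theorem sumSeries_mul {S T U : Set (Multiset ℕ)} (p : ℕ → Prop) [DecidablePred p]
    (hS0 : ∀ s ∈ S, 0 ∉ s) (hT0 : ∀ s ∈ T, 0 ∉ s)
    (hS : ∀ s ∈ S, ∀ i ∈ s, p i) (hT : ∀ s ∈ T, ∀ i ∈ s, ¬ p i)
    (hU : ∀ s, s ∈ U ↔ s.filter p ∈ S ∧ s.filter (fun i => ¬ p i) ∈ T) :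
    sumSeries U = sumSeries S * sumSeries T := by
  ext n
  rw [coeff_mul, coeff_sumSeries]
  simp only [coeff_sumSeries]
  have h1 := finite_fiber hS0
  have h2 := finite_fiber hT0
  rw [← Finset.sum_coe_sort]
  simp only [← Nat.cast_mul, ← Nat.cast_sum, ← Nat.card_prod]
  rw [← Nat.card_sigma]
  congr 1
  have key : ∀ a ∈ S, ∀ b ∈ T, (a + b).filter p = a ∧ (a + b).filter (fun i => ¬ p i) = b := by
    intro a ha b hb
    constructor
    · rw [Multiset.filter_add, Multiset.filter_eq_self.2 (hS a ha),
        Multiset.filter_eq_nil.2 (hT b hb), add_zero]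
    · rw [Multiset.filter_add, Multiset.filter_eq_self.2 (hT b hb),
        Multiset.filter_eq_nil.2 (fun i hi => not_not.2 (hS a ha i hi)), zero_add]
  symm
  refine Nat.card_congr (Equiv.ofBijective
    (fun x => ⟨x.2.1.1 + x.2.2.1, ?_, ?_⟩) ⟨?_, ?_⟩)
  · obtain ⟨_, ⟨a, ha, ha'⟩, b, hb, hb'⟩ := x
    rw [hU, (key a ha b hb).1, (key a ha b hb).2]
    exact ⟨ha, hb⟩
  · obtain ⟨⟨⟨i, j⟩, hij⟩, ⟨a, ha, ha'⟩, b, hb, hb'⟩ := x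
    rw [Finset.HasAntidiagonal.mem_antidiagonal] at hij
    dsimp only at ha' hb' hij ⊢
    rw [Multiset.sum_add, ha', hb', hij]
  · rintro ⟨⟨⟨i, j⟩, hij⟩, ⟨a, ha, ha'⟩, b, hb, hb'⟩ ⟨⟨⟨i', j'⟩, hij'⟩, ⟨a', haa, ha''⟩, b', hbb, hb''⟩ h
    simp only [Subtype.mk.injEq] at h
    have e1 : a = a' := by rw [← (key a ha b hb).1, h, (key a' haa b' hbb).1]
    have e2 : b = b' := by rw [← (key a ha b hb).2, h, (key a' haa b' hbb).2]
    subst e1 e2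
    obtain rfl : i = i' := ha'.symm.trans ha''
    obtain rfl : j = j' := hb'.symm.trans hb''
    rfl
  · rintro ⟨s, hs, hn⟩
    have := (hU s).1 hs
    have e := Multiset.filter_add_not p s
    refine ⟨⟨⟨((s.filter p).sum, (s.filter (fun i => ¬ p i)).sum), Finset.HasAntidiagonal.mem_antidiagonal.2 ?_⟩, ⟨s.filter p, this.1, rfl⟩,
      ⟨s.filter (fun i => ¬ p i), this.2, rfl⟩⟩, Subtype.ext e⟩
    rw [← Multiset.sum_add, e, hn]

theorem sumSeries_filter_lt {S : Set (Multiset ℕ)} (hS : ∀ s ∈ S, 0 ∉ s) (c : Multiset ℕ → ℕ)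
    (N : ℕ) : sumSeries {s | s ∈ S ∧ c s < N} =
      ∑ b ∈ Finset.range N, sumSeries {s | s ∈ S ∧ c s = b} := by
  induction N with
  | zero => ext n; simp [coeff_sumSeries]
  | succ N ih =>
    rw [Finset.sum_range_succ, ← ih, ← sumSeries_union (fun s h => hS s h.1) (fun s h => hS s h.1)]
    · congr 1
      ext s
      simp only [Set.mem_ofPred_eq, Set.mem_union]
      rw [← and_or_left, Nat.lt_succ_iff_lt_or_eq]
    · intro s h1 h2
      exact h1.2.ne h2.2

/-- Multisets with statistic at least `N` have sum at least `N`, so they do not affect lower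
coefficients. This stands in for summing over all values of `c`. -/
theorem X_pow_dvd_sumSeries_sub {S : Set (Multiset ℕ)} (hS : ∀ s ∈ S, 0 ∉ s) (c : Multiset ℕ → ℕ)
    (hc : ∀ s ∈ S, c s ≤ s.sum) (N : ℕ) :
    (X : ℤ⟦X⟧) ^ N ∣ sumSeries S - ∑ b ∈ Finset.range N, sumSeries {s | s ∈ S ∧ c s = b} := by
  rw [X_pow_dvd_iff, ← sumSeries_filter_lt hS]
  intro n hn
  rw [map_sub, coeff_sumSeries, coeff_sumSeries, sub_eq_zero]
  congr 1
  refine Nat.card_congr (Equiv.subtypeEquivRight fun s => ?_)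
  simp only [Set.mem_ofPred_eq]
  constructor
  · rintro ⟨h1, h2⟩
    exact ⟨⟨h1, by have := hc s h1; omega⟩, h2⟩
  · rintro ⟨h1, h2⟩
    exact ⟨h1.1, h2⟩

theorem card_le_sum_of_zero_notMem {s : Multiset ℕ} (hs : 0 ∉ s) : s.card ≤ s.sum := by
  have := Multiset.card_nsmul_le_sum (s := s) (a := 1)
    fun i hi => Nat.pos_of_ne_zero fun h => hs (h ▸ hi)
  simpa using this

theorem sumSeries_singleton_zero : sumSeries {s | s = 0} = 1 := by
  ext n
  rw [coeff_sumSeries, coeff_one]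
  split_ifs with h
  · subst h
    rw [Nat.card_eq_one_iff_unique.2 ⟨⟨fun a b => Subtype.ext (a.2.1.trans b.2.1.symm)⟩,
      ⟨⟨0, rfl, rfl⟩⟩⟩]
    rfl
  · have : IsEmpty {s : Multiset ℕ // s ∈ {s : Multiset ℕ | s = 0} ∧ s.sum = n} := by
      refine ⟨?_⟩
      rintro ⟨_, rfl, hn⟩
      exact h hn.symm
    rw [Nat.card_of_isEmpty, Nat.cast_zero]

theorem sumSeries_empty : sumSeries ∅ = 0 := by
  ext n; simp [coeff_sumSeries]

/-! ### `q`-series of large and small parts -/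

/-- Multisets of size `b` all of whose elements exceed `k`. -/
def largeParts (k b : ℕ) : Set (Multiset ℕ) := {s | (∀ i ∈ s, k < i) ∧ s.card = b}

/-- Multisets of size at most `b` whose set of elements is `{1, …, k}`. -/
def smallParts (k b : ℕ) : Set (Multiset ℕ) :=
  {s | (∀ i, i ∈ s ↔ 0 < i ∧ i ≤ k) ∧ s.card ≤ b}

/-- The `q`-factorial `(1 - X) ⋯ (1 - X ^ k)`. -/
noncomputable def qFactorial (k : ℕ) : ℤ⟦X⟧ := ∏ i ∈ Finset.range k, (1 - X ^ (i + 1))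

theorem qFactorial_zero : qFactorial 0 = 1 := rfl

theorem qFactorial_succ (k : ℕ) : qFactorial (k + 1) = qFactorial k * (1 - X ^ (k + 1)) :=
  Finset.prod_range_succ _ _

theorem one_sub_X_pow_ne_zero (k : ℕ) : (1 - X ^ (k + 1) : ℤ⟦X⟧) ≠ 0 := by
  intro h
  have := congrArg (coeff 0) h
  simp at this

theorem qFactorial_ne_zero (k : ℕ) : qFactorial k ≠ 0 :=
  Finset.prod_ne_zero_iff.2 fun i _ => one_sub_X_pow_ne_zero i

theorem zero_notMem_of_forall_lt {k : ℕ} {s : Multiset ℕ} (h : ∀ i ∈ s, k < i) : 0 ∉ s :=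
  fun h0 => absurd (h 0 h0) (Nat.not_lt_zero k)

theorem sumSeries_largeParts_zero (k : ℕ) : sumSeries (largeParts k 0) = 1 := by
  rw [← sumSeries_singleton_zero]
  congr 1
  ext s
  simp only [largeParts, Set.mem_ofPred_eq, Multiset.card_eq_zero]
  refine ⟨fun h => h.2, ?_⟩
  rintro rfl
  simp

/-- Adding 1 to each of the `b` parts is a bijection. -/
theorem sumSeries_largeParts_succ_left (k b : ℕ) :
    sumSeries (largeParts (k + 1) b) = X ^ b * sumSeries (largeParts k b) := by
  rw [← sumSeries_image (f := Multiset.map (· + 1))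
    (Multiset.map_injective (add_left_injective 1)).injOn]
  · congr 1
    ext s
    simp only [largeParts, Set.mem_ofPred_eq, Set.mem_image]
    constructor
    · rintro ⟨h1, h2⟩
      refine ⟨s.map (· - 1), ⟨?_, by simpa using h2⟩, ?_⟩
      · intro i hi
        obtain ⟨j, hj, rfl⟩ := Multiset.mem_map.1 hi
        have := h1 j hj
        omega
      · rw [Multiset.map_map]
        conv_rhs => rw [← Multiset.map_id s]
        refine Multiset.map_congr rfl fun i hi => ?_
        have := h1 i hi
        simp only [Function.comp_apply, id]
        omega
    · rintro ⟨t, ⟨h1, h2⟩, rfl⟩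
      refine ⟨?_, by simpa using h2⟩
      intro i hi
      obtain ⟨j, hj, rfl⟩ := Multiset.mem_map.1 hi
      have := h1 j hj
      omega
  · rintro s ⟨-, rfl⟩
    rw [Multiset.sum_map_add]
    simp

theorem sumSeries_largeParts_succ_right (k b : ℕ) :
    sumSeries (largeParts k (b + 1)) =
      X ^ (k + 1) * sumSeries (largeParts k b) + sumSeries (largeParts (k + 1) (b + 1)) := by
  rw [← sumSeries_image (f := Multiset.cons (k + 1)) (d := k + 1)
    (fun s _ t _ h => (Multiset.cons_inj_right _).1 h)
    (fun s _ => by rw [Multiset.sum_cons, add_comm]), ← sumSeries_union]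
  · congr 1
    ext s
    simp only [largeParts, Set.mem_ofPred_eq, Set.mem_image, Set.mem_union]
    constructor
    · rintro ⟨h1, h2⟩
      by_cases hk : k + 1 ∈ s
      · obtain ⟨t, rfl⟩ := Multiset.exists_cons_of_mem hk
        exact Or.inl ⟨t, ⟨fun i hi => h1 i (Multiset.mem_cons_of_mem hi), by simpa using h2⟩, rfl⟩
      · refine Or.inr ⟨fun i hi => lt_of_le_of_ne (h1 i hi) ?_, h2⟩
        rintro rfl
        exact hk hi
    · rintro (⟨t, ⟨h1, h2⟩, rfl⟩ | ⟨h1, h2⟩)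
      · refine ⟨fun i hi => ?_, by simpa using h2⟩
        rcases Multiset.mem_cons.1 hi with rfl | hi
        · exact k.lt_succ_self
        · exact h1 i hi
      · exact ⟨fun i hi => (Nat.lt_succ_self k).trans (h1 i hi), h2⟩
  · rintro _ ⟨t, ht, rfl⟩ h0
    rcases Multiset.mem_cons.1 h0 with h | h
    · exact absurd h (Nat.succ_ne_zero k).symm
    · exact zero_notMem_of_forall_lt ht.1 h
  · exact fun s hs => zero_notMem_of_forall_lt hs.1
  · rintro _ ⟨t, ht, rfl⟩ h
    exact lt_irrefl _ (h.1 (k + 1) (Multiset.mem_cons_self _ _))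

theorem qFactorial_mul_sumSeries_largeParts (k b : ℕ) :
    qFactorial b * sumSeries (largeParts k b) = X ^ ((k + 1) * b) := by
  induction b with
  | zero => rw [sumSeries_largeParts_zero, qFactorial_zero]; simp
  | succ b ih =>
    have h := sumSeries_largeParts_succ_right k b
    rw [sumSeries_largeParts_succ_left] at h
    rw [qFactorial_succ, mul_add_one, pow_add _ _ (k + 1), ← ih]
    linear_combination qFactorial b * h

theorem sumSeries_smallParts_zero_left (b : ℕ) : sumSeries (smallParts 0 b) = 1 := by
  rw [← sumSeries_singleton_zero]
  congr 1
  ext s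
  simp only [smallParts, Set.mem_ofPred_eq]
  constructor
  · rintro ⟨h, -⟩
    refine Multiset.eq_zero_of_forall_notMem fun i hi => ?_
    have := (h i).1 hi
    omega
  · rintro rfl
    refine ⟨fun i => ?_, by simp⟩
    simp only [Multiset.notMem_zero, false_iff]
    omega

theorem sumSeries_smallParts_zero_right (k : ℕ) : sumSeries (smallParts (k + 1) 0) = 0 := by
  rw [← sumSeries_empty]
  congr 1
  rw [Set.eq_empty_iff_forall_notMem]
  rintro s ⟨h1, h2⟩
  have h := (h1 (k + 1)).2 ⟨k.succ_pos, le_rfl⟩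
  rw [Multiset.card_eq_zero.1 (Nat.le_zero.1 h2)] at h
  exact Multiset.notMem_zero _ h

/-- Remove one copy of `k + 1`; the two summands record whether it was the last one. This is a
`q`-Pascal rule. -/
theorem sumSeries_smallParts_succ (k b : ℕ) :
    sumSeries (smallParts (k + 1) (b + 1)) =
      X ^ (k + 1) * (sumSeries (smallParts k b) + sumSeries (smallParts (k + 1) b)) := by
  rw [← sumSeries_union, ← sumSeries_image (f := Multiset.cons (k + 1)) (d := k + 1)
    (fun s _ t _ h => (Multiset.cons_inj_right _).1 h)
    (fun s _ => by rw [Multiset.sum_cons, add_comm])]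
  · congr 1
    ext s
    simp only [smallParts, Set.mem_ofPred_eq, Set.mem_image, Set.mem_union]
    constructor
    · rintro ⟨h1, h2⟩
      obtain ⟨t, rfl⟩ := Multiset.exists_cons_of_mem ((h1 (k + 1)).2 ⟨k.succ_pos, le_rfl⟩)
      have h2' : t.card ≤ b := by simpa using h2
      refine ⟨t, ?_, rfl⟩
      simp only [Multiset.mem_cons] at h1
      by_cases hk : k + 1 ∈ t
      · refine Or.inr ⟨fun i => ?_, h2'⟩
        rw [← h1 i]
        refine ⟨Or.inr, ?_⟩
        rintro (rfl | h)
        exacts [hk, h]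
      · refine Or.inl ⟨fun i => ?_, h2'⟩
        have h := h1 i
        by_cases hi : i = k + 1
        · subst hi
          simp only [hk, false_iff]
          omega
        · simp only [hi, false_or] at h
          rw [h]
          omega
    · rintro ⟨t, ⟨h1, h2⟩ | ⟨h1, h2⟩, rfl⟩ <;>
      · refine ⟨fun i => ?_, by simpa using h2⟩
        rw [Multiset.mem_cons, h1]
        omega
  · exact fun s hs h0 => absurd ((hs.1 0).1 h0).1 (lt_irrefl 0)
  · exact fun s hs h0 => absurd ((hs.1 0).1 h0).1 (lt_irrefl 0)
  · intro s h1 h2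
    have := (h1.1 (k + 1)).1 ((h2.1 (k + 1)).2 ⟨k.succ_pos, le_rfl⟩)
    omega

theorem sumSeries_smallParts_of_lt {k b : ℕ} (h : b < k) : sumSeries (smallParts k b) = 0 := by
  induction b generalizing k with
  | zero =>
    obtain ⟨k, rfl⟩ := Nat.exists_eq_succ_of_ne_zero h.ne'
    exact sumSeries_smallParts_zero_right k
  | succ b ih =>
    obtain ⟨k, rfl⟩ := Nat.exists_eq_succ_of_ne_zero (Nat.ne_zero_of_lt h)
    rw [Nat.succ_eq_add_one, sumSeries_smallParts_succ, ih (by omega), ih (by omega)]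
    simp

/-- Removing one copy of each of `1, …, k` leaves at most `m` parts, all at most `k`: a Gaussian
binomial, here with denominators cleared. -/
theorem sumSeries_smallParts_mul (k m : ℕ) :
    sumSeries (smallParts k (k + m)) * (qFactorial k * qFactorial m) =
      X ^ (k + 1).choose 2 * qFactorial (k + m) := by
  induction h : k + m generalizing k m with
  | zero =>
    obtain ⟨rfl, rfl⟩ : k = 0 ∧ m = 0 := by omega
    rw [sumSeries_smallParts_zero_left, qFactorial_zero]
    simp
  | succ n ih =>
    rcases k with _ | k
    · rw [sumSeries_smallParts_zero_left, ← h, qFactorial_zero, zero_add]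
      simp
    obtain rfl : n = k + m := by omega
    have h1 := ih k m rfl
    -- The factor `1 - X ^ m` also covers `m = 0`, where both sides vanish.
    have h2 : sumSeries (smallParts (k + 1) (k + m)) * (qFactorial (k + 1) * qFactorial m) =
        (1 - X ^ m) * (X ^ (k + 2).choose 2 * qFactorial (k + m)) := by
      rcases m with _ | m
      · rw [sumSeries_smallParts_of_lt (by omega)]
        simp
      · rw [← ih (k + 1) m (by omega), qFactorial_succ m]
        ring
    have h3 : (k + 2).choose 2 = (k + 1) + (k + 1).choose 2 := by
      rw [Nat.choose_succ_succ' (k + 1) 1, Nat.choose_one_right]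
    rw [h3, qFactorial_succ k] at h2
    rw [sumSeries_smallParts_succ, h3, qFactorial_succ (k + m), qFactorial_succ k]
    linear_combination (X : ℤ⟦X⟧) ^ (k + 1) * (1 - X ^ (k + 1)) * h1 + (X : ℤ⟦X⟧) ^ (k + 1) * h2

/-! ### Partitions with prescribed least missing part -/

/-- Partitions whose least missing part is `k + 1` and that have more parts above `k + 1` than
below it. -/
def mexParts (k : ℕ) : Set (Multiset ℕ) :=
  {s | 0 ∉ s ∧ IsLeast {m : ℕ | 0 < m ∧ m ∉ s} (k + 1) ∧
    (s.filter fun i => i < k + 1).card < (s.filter fun i => k + 1 < i).card}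

/-- Multisets all of whose elements exceed `k`. -/
def partsAbove (k : ℕ) : Set (Multiset ℕ) := {s | ∀ i ∈ s, k < i}

theorem X_pow_dvd_partsAbove_sub (k N : ℕ) : (X : ℤ⟦X⟧) ^ N ∣
    sumSeries (partsAbove k) - ∑ b ∈ Finset.range N, sumSeries (largeParts k b) :=
  X_pow_dvd_sumSeries_sub (S := partsAbove k) (fun _ hs => zero_notMem_of_forall_lt hs)
    Multiset.card (fun _ hs => card_le_sum_of_zero_notMem (zero_notMem_of_forall_lt hs)) N

theorem sumSeries_partsAbove_succ (k : ℕ) :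
    sumSeries (partsAbove (k + 1)) = (1 - X ^ (k + 1)) * sumSeries (partsAbove k) := by
  have h : sumSeries (partsAbove k) =
      X ^ (k + 1) * sumSeries (partsAbove k) + sumSeries (partsAbove (k + 1)) := by
    rw [← sumSeries_image (f := Multiset.cons (k + 1)) (d := k + 1)
      (fun s _ t _ h => (Multiset.cons_inj_right _).1 h)
      (fun s _ => by rw [Multiset.sum_cons, add_comm]), ← sumSeries_union]
    rotate_left
    · rintro _ ⟨t, ht, rfl⟩ h0
      rcases Multiset.mem_cons.1 h0 with h | h
      · exact absurd h (Nat.succ_ne_zero k).symm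
      · exact zero_notMem_of_forall_lt ht h
    · exact fun s hs => zero_notMem_of_forall_lt hs
    · rintro _ ⟨t, ht, rfl⟩ h
      exact lt_irrefl _ (h (k + 1) (Multiset.mem_cons_self _ _))
    congr 1
    ext s
    simp only [partsAbove, Set.mem_ofPred_eq, Set.mem_image, Set.mem_union]
    constructor
    · intro h1
      by_cases hk : k + 1 ∈ s
      · obtain ⟨t, rfl⟩ := Multiset.exists_cons_of_mem hk
        exact Or.inl ⟨t, fun i hi => h1 i (Multiset.mem_cons_of_mem hi), rfl⟩
      · refine Or.inr fun i hi => lt_of_le_of_ne (h1 i hi) ?_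
        rintro rfl
        exact hk hi
    · rintro (⟨t, h1, rfl⟩ | h1)
      · intro i hi
        rcases Multiset.mem_cons.1 hi with rfl | hi
        · exact k.lt_succ_self
        · exact h1 i hi
      · exact fun i hi => (Nat.lt_succ_self k).trans (h1 i hi)
  linear_combination -h

theorem sumSeries_partsAbove (k : ℕ) :
    sumSeries (partsAbove k) = qFactorial k * sumSeries (partsAbove 0) := by
  induction k with
  | zero => rw [qFactorial_zero, one_mul]
  | succ k ih => rw [sumSeries_partsAbove_succ, ih, qFactorial_succ]; ring

/-- The strict inequality forces at least one part above `k + 1`, so the subtraction does not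
truncate; with `b + 1` such parts it says that at most `b` lie below. -/
theorem sumSeries_mexParts_fiber (k b : ℕ) :
    sumSeries {s | s ∈ mexParts k ∧ (s.filter fun i => k + 1 < i).card - 1 = b} =
      sumSeries (smallParts k b) * sumSeries (largeParts (k + 1) (b + 1)) := by
  refine sumSeries_mul (fun i => i < k + 1)
    (fun s hs h0 => absurd ((hs.1 0).1 h0).1 (lt_irrefl 0))
    (fun s hs => zero_notMem_of_forall_lt hs.1)
    (fun s hs i hi => Nat.lt_succ_of_le ((hs.1 i).1 hi).2)
    (fun s hs i hi => by have := hs.1 i hi; omega) ?_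
  intro s
  have hfilter : k + 1 ∉ s →
      s.filter (fun i => ¬ i < k + 1) = s.filter fun i => k + 1 < i := by
    intro hk
    refine Multiset.filter_congr fun i hi => ?_
    have : i ≠ k + 1 := by rintro rfl; exact hk hi
    omega
  simp only [mexParts, smallParts, largeParts, IsLeast, lowerBounds, Set.mem_ofPred_eq,
    Multiset.mem_filter]
  constructor
  · rintro ⟨⟨h0, ⟨⟨-, hk⟩, hmin⟩, hlt⟩, hb⟩
    rw [hfilter hk]
    refine ⟨⟨fun i => ⟨?_, ?_⟩, by omega⟩, ?_, by omega⟩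
    · rintro ⟨hi, hik⟩
      exact ⟨Nat.pos_of_ne_zero (by rintro rfl; exact h0 hi), by omega⟩
    · rintro ⟨hi, hik⟩
      refine ⟨?_, by omega⟩
      by_contra his
      have := hmin ⟨hi, his⟩
      omega
    · rintro i ⟨hi, hik⟩
      have : i ≠ k + 1 := by rintro rfl; exact hk hi
      omega
  · rintro ⟨⟨h1, h2⟩, h3, h4⟩
    have hk : k + 1 ∉ s := fun h => lt_irrefl _ (h3 (k + 1) ⟨h, lt_irrefl _⟩)
    rw [hfilter hk] at h4
    refine ⟨⟨?_, ⟨⟨k.succ_pos, hk⟩, ?_⟩, by omega⟩, by omega⟩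
    · intro h0
      have := ((h1 0).1 ⟨h0, k.succ_pos⟩).1
      omega
    · rintro i ⟨hi, his⟩
      by_contra hik
      exact his ((h1 i).2 ⟨hi, by omega⟩).1

theorem X_pow_dvd_mexParts_sub (k N : ℕ) : (X : ℤ⟦X⟧) ^ N ∣ sumSeries (mexParts k) -
    ∑ b ∈ Finset.range N, sumSeries (smallParts k b) * sumSeries (largeParts (k + 1) (b + 1)) := by
  simp only [← sumSeries_mexParts_fiber]
  refine X_pow_dvd_sumSeries_sub (fun _ hs => hs.1) _ (fun s hs => ?_) N
  have h1 := Multiset.card_le_card (Multiset.filter_le (fun i => k + 1 < i) s)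
  have h2 := card_le_sum_of_zero_notMem hs.1
  omega

theorem smallParts_mul_largeParts_add (k m : ℕ) :
    qFactorial (k + 1) *
      (sumSeries (smallParts k (k + m)) * sumSeries (largeParts (k + 1) (k + m + 1)) +
        sumSeries (smallParts (k + 1) (k + m)) * sumSeries (largeParts (k + 2) (k + m + 1))) =
      X ^ ((k + 1).choose 2 + (k + 1) * (k + 2)) *
        ((1 - X ^ (k + 1)) * sumSeries (largeParts (k + 1) m) +
          X ^ (k + 1) * sumSeries (largeParts (k + 2) m)) := by
  -- These factors clear the denominators of all four series.
  refine mul_left_cancel₀ (mul_ne_zero (qFactorial_ne_zero m) (qFactorial_ne_zero (k + m + 1))) ?_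
  have h1 := sumSeries_smallParts_mul k m
  have h2 : sumSeries (smallParts (k + 1) (k + m)) * (qFactorial (k + 1) * qFactorial m) =
      (1 - X ^ m) * (X ^ ((k + 1) + (k + 1).choose 2) * qFactorial (k + m)) := by
    have h3 : (k + 1 + 1).choose 2 = (k + 1) + (k + 1).choose 2 := by
      rw [Nat.choose_succ_succ' (k + 1) 1, Nat.choose_one_right]
    rcases m with _ | m
    · rw [sumSeries_smallParts_of_lt (by omega)]
      simp
    · have := sumSeries_smallParts_mul (k + 1) m
      rw [show k + (m + 1) = k + 1 + m by ring, ← h3, ← this, qFactorial_succ m]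
      ring
  have h4 := qFactorial_mul_sumSeries_largeParts (k + 1) (k + m + 1)
  have h5 := qFactorial_mul_sumSeries_largeParts (k + 1) m
  rw [sumSeries_largeParts_succ_left (k + 1) (k + m + 1), sumSeries_largeParts_succ_left (k + 1) m]
  generalize sumSeries (largeParts (k + 1) (k + m + 1)) = B at *
  generalize sumSeries (largeParts (k + 1) m) = B' at *
  generalize sumSeries (smallParts k (k + m)) = A at *
  generalize sumSeries (smallParts (k + 1) (k + m)) = A' at *
  have h6 := qFactorial_succ (k + m)
  have h7 := qFactorial_succ k
  generalize qFactorial (k + m + 1) = Q at *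
  generalize qFactorial (k + m) = Q' at *
  generalize qFactorial (k + 1) = K at *
  generalize qFactorial k = K' at *
  generalize qFactorial m = R at *
  have e1 : R * Q * (K * (A * B + A' * (X ^ (k + m + 1) * B))) =
      (1 - X ^ (k + 1)) * (A * (K' * R)) * (Q * B) +
        X ^ (k + m + 1) * (A' * (K * R)) * (Q * B) := by
    rw [h7]; ring
  have e2 : R * Q * (X ^ ((k + 1).choose 2 + (k + 1) * (k + 2)) *
      ((1 - X ^ (k + 1)) * B' + X ^ (k + 1) * (X ^ m * B'))) =
      Q * X ^ ((k + 1).choose 2 + (k + 1) * (k + 2)) *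
      ((1 - X ^ (k + 1)) + X ^ (k + 1) * X ^ m) * (R * B') := by
    ring
  rw [e1, e2, h1, h2, h4, h5, h6]
  ring

/-- Summing the termwise identity over `m` turns `largeParts` into `partsAbove`, and `(1 - X^(k+1))
+ X^(k+1) (1 - X^(k+2)) = 1 - X^(2k+3)`. -/
theorem sumSeries_mexParts_add (k : ℕ) :
    sumSeries (mexParts k) + sumSeries (mexParts (k + 1)) =
      X ^ ((k + 1).choose 2 + (k + 1) * (k + 2)) * (1 - X ^ (2 * k + 3)) *
        sumSeries (partsAbove 0) := by
  refine mul_left_cancel₀ (qFactorial_ne_zero (k + 1)) (sub_eq_zero.1 ?_)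
  set E : ℤ⟦X⟧ := X ^ ((k + 1).choose 2 + (k + 1) * (k + 2)) with hE
  ext n
  rw [map_zero]
  refine X_pow_dvd_iff.1 (?_ : (X : ℤ⟦X⟧) ^ (n + 1) ∣ _) n n.lt_succ_self
  -- Terms with `b < k` vanish, so cutting at `k + (n + 1)` leaves `b = k + m` with `m ≤ n`.
  have d1 := (pow_dvd_pow (X : ℤ⟦X⟧) (Nat.le_add_left (n + 1) k)).trans
    (X_pow_dvd_mexParts_sub k (k + (n + 1)))
  have d2 := (pow_dvd_pow (X : ℤ⟦X⟧) (Nat.le_add_left (n + 1) k)).trans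
    (X_pow_dvd_mexParts_sub (k + 1) (k + (n + 1)))
  have d3 := X_pow_dvd_partsAbove_sub (k + 1) (n + 1)
  have d4 := X_pow_dvd_partsAbove_sub (k + 2) (n + 1)
  have z1 : ∑ b ∈ Finset.range k, sumSeries (smallParts k b) *
      sumSeries (largeParts (k + 1) (b + 1)) = 0 :=
    Finset.sum_eq_zero fun b hb => by
      rw [sumSeries_smallParts_of_lt (Finset.mem_range.1 hb), zero_mul]
  have z2 : ∑ b ∈ Finset.range k, sumSeries (smallParts (k + 1) b) *
      sumSeries (largeParts (k + 1 + 1) (b + 1)) = 0 :=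
    Finset.sum_eq_zero fun b hb => by
      rw [sumSeries_smallParts_of_lt ((Finset.mem_range.1 hb).trans k.lt_succ_self), zero_mul]
  rw [Finset.sum_range_add, z1, zero_add] at d1
  rw [Finset.sum_range_add, z2, zero_add] at d2
  have s := Finset.sum_congr (rfl : Finset.range (n + 1) = Finset.range (n + 1))
    fun m _ => smallParts_mul_largeParts_add k m
  rw [← Finset.mul_sum, ← Finset.mul_sum, Finset.sum_add_distrib, Finset.sum_add_distrib,
    ← Finset.mul_sum, ← Finset.mul_sum, ← hE] at s
  have a1 := sumSeries_partsAbove (k + 1)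
  have a2 := sumSeries_partsAbove_succ (k + 1)
  have := ((d1.add d2).mul_left (qFactorial (k + 1))).sub
    (((d3.mul_left (1 - X ^ (k + 1))).add (d4.mul_left (X ^ (k + 1)))).mul_left E)
  convert this using 1
  rw [mul_add (qFactorial (k + 1)), mul_add (qFactorial (k + 1))]
  linear_combination s + E * (1 - X ^ (2 * k + 3)) * a1 + E * X ^ (k + 1) * a2

/-- With 1 missing nothing lies below it, so only the empty partition fails the inequality. -/
theorem sumSeries_mexParts_zero :
    sumSeries (mexParts 0) = (1 - X) * sumSeries (partsAbove 0) - 1 := by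
  have h := sumSeries_partsAbove_succ 0
  have h2 : sumSeries (partsAbove 1) = sumSeries {s | s = 0} + sumSeries (mexParts 0) := by
    rw [← sumSeries_union]
    · congr 1
      ext s
      simp only [partsAbove, mexParts, IsLeast, lowerBounds, Set.mem_ofPred_eq, Set.mem_union]
      constructor
      · intro hs
        refine or_iff_not_imp_left.2 fun hne => ⟨zero_notMem_of_forall_lt hs,
          ⟨⟨one_pos, fun h => lt_irrefl _ (hs 1 h)⟩, fun i hi => hi.1⟩, ?_⟩
        rw [Multiset.filter_eq_nil.2 (fun i hi => by have := hs i hi; omega),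
          Multiset.filter_eq_self.2 hs]
        exact Multiset.card_pos.2 hne
      · rintro (rfl | ⟨h0, ⟨⟨-, h1⟩, -⟩, -⟩) i hi
        · exact absurd hi (Multiset.notMem_zero i)
        · have : i ≠ 0 := by rintro rfl; exact h0 hi
          have : i ≠ 1 := by rintro rfl; exact h1 hi
          omega
    · rintro s rfl
      exact Multiset.notMem_zero 0
    · exact fun s hs => hs.1
    · rintro s rfl h
      exact absurd h.2.2 (by simp)
  rw [sumSeries_singleton_zero] at h2
  rw [zero_add, pow_one] at h
  rw [← h]
  linear_combination -h2

/-! ### Counting functions as coefficients -/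

theorem card_filter_partition (Q : Multiset ℕ → Prop) (n : ℕ)
    [DecidablePred fun π : Nat.Partition n => Q π.parts] :
    ((Finset.univ.filter fun π : Nat.Partition n => Q π.parts).card : ℤ) =
      coeff n (sumSeries {s | 0 ∉ s ∧ Q s}) := by
  rw [coeff_sumSeries, ← Fintype.card_subtype, ← Nat.card_eq_fintype_card]
  congr 1
  refine Nat.card_congr (Equiv.ofBijective (fun π => ⟨π.1.parts,
    ⟨fun h => absurd (π.1.parts_pos h) (lt_irrefl 0), π.2⟩, π.1.parts_sum⟩) ⟨?_, ?_⟩)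
  · intro π σ h
    exact Subtype.ext (Nat.Partition.ext (congrArg Subtype.val h))
  · rintro ⟨s, ⟨h0, hs⟩, hn⟩
    exact ⟨⟨⟨s, fun {i} hi => Nat.pos_of_ne_zero fun h => h0 (h ▸ hi), hn⟩, hs⟩, rfl⟩

theorem partitionCount_natCast (n : ℕ) :
    (partitionCount n : ℤ) = coeff n (sumSeries (partsAbove 0)) := by
  classical
  have h := card_filter_partition (fun _ => True) n
  rw [Finset.filter_true, Finset.card_univ] at h
  rw [partitionCount, if_pos (Int.natCast_nonneg n), Int.toNat_natCast, h]
  congr 2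
  ext s
  simp only [partsAbove, Set.mem_ofPred_eq, and_true, pos_iff_ne_zero]
  exact ⟨fun h i hi h0 => h (h0 ▸ hi), fun h h0 => h 0 h0 rfl⟩

theorem sixRegularCount_eq_coeff (n : ℕ) :
    (sixRegularCount n : ℤ) = coeff n (sumSeries {s | 0 ∉ s ∧ ∀ i ∈ s, ¬ 6 ∣ i}) :=
  card_filter_partition (fun s => ∀ i ∈ s, ¬ 6 ∣ i) n

theorem andrewsMerca_eq_coeff (k n : ℕ) :
    (andrewsMerca (k + 1) n : ℤ) = coeff n (sumSeries (mexParts k)) := by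
  classical
  exact card_filter_partition (fun s => IsLeast {m : ℕ | 0 < m ∧ m ∉ s} (k + 1) ∧
    (s.filter fun i => i < k + 1).card < (s.filter fun i => k + 1 < i).card) n

/-! ### Separating the multiples of 6 -/

/-- The expansion `X ↦ X ^ 6`. -/
noncomputable def expandSix : ℤ⟦X⟧ →ₐ[ℤ] ℤ⟦X⟧ := PowerSeries.expand 6 (by norm_num)

theorem sumSeries_six_dvd :
    sumSeries {s | 0 ∉ s ∧ ∀ i ∈ s, 6 ∣ i} = expandSix (sumSeries (partsAbove 0)) := by
  ext n
  rw [expandSix, coeff_expand, coeff_sumSeries]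
  split_ifs with h
  · obtain ⟨m, rfl⟩ := h
    rw [Nat.mul_div_cancel_left m (by norm_num), coeff_sumSeries]
    congr 1
    symm
    refine Nat.card_congr (Equiv.ofBijective (fun s => ⟨s.1.map (6 * ·), ⟨?_, ?_⟩, ?_⟩) ⟨?_, ?_⟩)
    · intro h0
      obtain ⟨j, hj, hj0⟩ := Multiset.mem_map.1 h0
      have := s.2.1 j hj
      omega
    · intro i hi
      obtain ⟨j, hj, rfl⟩ := Multiset.mem_map.1 hi
      exact Dvd.intro j rfl
    · rw [Multiset.sum_map_mul_left, Multiset.map_id', s.2.2]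
    · intro s t h
      exact Subtype.ext (Multiset.map_injective (mul_right_injective₀ (by norm_num : (6 : ℕ) ≠ 0))
        (congrArg Subtype.val h))
    · rintro ⟨s, ⟨h0, hs⟩, hn⟩
      have e : (s.map (· / 6)).map (6 * ·) = s := by
        rw [Multiset.map_map]
        conv_rhs => rw [← Multiset.map_id s]
        exact Multiset.map_congr rfl fun i hi => Nat.mul_div_cancel' (hs i hi)
      refine ⟨⟨s.map (· / 6), ?_, ?_⟩, Subtype.ext e⟩
      · intro i hi
        obtain ⟨j, hj, rfl⟩ := Multiset.mem_map.1 hi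
        have h1 : j ≠ 0 := by rintro rfl; exact h0 hj
        have h2 := hs j hj
        omega
      · rw [← e, Multiset.sum_map_mul_left, Multiset.map_id'] at hn
        omega
  · have : IsEmpty {s : Multiset ℕ // s ∈ {s : Multiset ℕ | 0 ∉ s ∧ ∀ i ∈ s, 6 ∣ i} ∧
        s.sum = n} := by
      refine ⟨?_⟩
      rintro ⟨s, ⟨-, hs⟩, rfl⟩
      exact h (Multiset.dvd_sum hs)
    rw [Nat.card_of_isEmpty, Nat.cast_zero]

theorem sumSeries_partsAbove_zero_eq_mul : sumSeries (partsAbove 0) =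
    sumSeries {s | 0 ∉ s ∧ ∀ i ∈ s, ¬ 6 ∣ i} * expandSix (sumSeries (partsAbove 0)) := by
  rw [← sumSeries_six_dvd]
  refine sumSeries_mul (fun i => ¬ 6 ∣ i) (fun s hs => hs.1) (fun s hs => hs.1)
    (fun s hs => hs.2) (fun s hs i hi => not_not.2 (hs.2 i hi)) fun s => ?_
  simp only [partsAbove, Set.mem_ofPred_eq, Multiset.mem_filter, not_not]
  constructor
  · intro h
    exact ⟨⟨fun h0 => absurd (h 0 h0.1) (lt_irrefl 0), fun i hi => hi.2⟩,
      fun h0 => absurd (h 0 h0.1) (lt_irrefl 0), fun i hi => hi.2⟩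
  · rintro ⟨-, h, -⟩ i hi
    exact Nat.pos_of_ne_zero fun h0 => h ⟨h0 ▸ hi, dvd_zero 6⟩

/-! ### The truncated pentagonal number theorem and extraction of coefficients -/

/-- The truncated pentagonal number series; the terms of indices `-j` and `j + 1` are paired. -/
noncomputable def pentagonalTrunc (k : ℕ) : ℤ⟦X⟧ :=
  ∑ j ∈ Finset.range k, (-1) ^ j *
    (X ^ ((j + 1).choose 2 + j ^ 2) - X ^ ((j + 1).choose 2 + j ^ 2 + (2 * j + 1)))

/-- The Andrews-Merca truncated pentagonal number theorem. -/
theorem sumSeries_partsAbove_mul_pentagonalTrunc (k : ℕ) :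
    sumSeries (partsAbove 0) * pentagonalTrunc (k + 1) =
      1 + (-1) ^ k * sumSeries (mexParts k) := by
  induction k with
  | zero =>
    rw [sumSeries_mexParts_zero, pentagonalTrunc]
    simp
    ring
  | succ k ih =>
    have h := sumSeries_mexParts_add k
    have h3 : (k + 1 + 1).choose 2 = (k + 1) + (k + 1).choose 2 := by
      rw [Nat.choose_succ_succ' (k + 1) 1, Nat.choose_one_right]
    rw [pentagonalTrunc, Finset.sum_range_succ, ← pentagonalTrunc, mul_add, ih, h3,
      show k + 1 + (k + 1).choose 2 + (k + 1) ^ 2 =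
        (k + 1).choose 2 + (k + 1) * (k + 2) by ring]
    linear_combination (-1) ^ k * h

theorem sum_Icc_neg_eq_sum_range (F : ℤ → ℤ) (k : ℕ) :
    ∑ j ∈ Finset.Icc (-((k : ℤ) - 1)) (k : ℤ), F j =
      ∑ j ∈ Finset.range k, (F (-(j : ℤ)) + F ((j : ℤ) + 1)) := by
  induction k with
  | zero => simp
  | succ k ih =>
    rw [Finset.sum_range_succ, ← ih]
    have e : Finset.Icc (-(((k + 1 : ℕ) : ℤ) - 1)) ((k + 1 : ℕ) : ℤ) =
        insert (-(k : ℤ)) (insert ((k : ℤ) + 1) (Finset.Icc (-((k : ℤ) - 1)) (k : ℤ))) := by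
      ext j
      simp only [Finset.mem_insert, Finset.mem_Icc]
      omega
    rw [e, Finset.sum_insert, Finset.sum_insert]
    · ring
    · simp
    · simp only [Finset.mem_insert, Finset.mem_Icc]
      omega

theorem partitionCount_sub (n d : ℕ) : (partitionCount ((n : ℤ) - d) : ℤ) =
    coeff n (sumSeries (partsAbove 0) * X ^ d) := by
  rw [coeff_mul_X_pow']
  split_ifs with h
  · rw [← partitionCount_natCast, Nat.cast_sub h]
  · rw [partitionCount, if_neg (by omega), Nat.cast_zero]

/-- The shift `3j(3j-1)` is six times the pentagonal number `j(3j-1)/2`. -/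
theorem sum_partitionCount_eq_coeff (n k : ℕ) :
    ∑ j ∈ Finset.Icc (-((k : ℤ) - 1)) (k : ℤ),
        (j.negOnePow : ℤ) * (partitionCount ((n : ℤ) - 3 * j * (3 * j - 1)) : ℤ) =
      coeff n (sumSeries (partsAbove 0) * expandSix (pentagonalTrunc k)) := by
  rw [sum_Icc_neg_eq_sum_range (fun j =>
    (j.negOnePow : ℤ) * (partitionCount ((n : ℤ) - 3 * j * (3 * j - 1)) : ℤ)), pentagonalTrunc,
    map_sum, Finset.mul_sum, map_sum]
  refine Finset.sum_congr rfl fun j _ => ?_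
  have ht : 2 * ((j + 1).choose 2 : ℤ) = j * (j + 1) := by
    have h := Nat.add_one_mul_choose_eq j 1
    rw [Nat.choose_one_right] at h
    zify at h
    linear_combination -h
  have hX : ∀ d, expandSix (X ^ d) = X ^ (6 * d) := fun d => by
    rw [map_pow, expandSix, expand_X, ← pow_mul]
  have hs0 : ((j : ℤ).negOnePow : ℤ) = (-1) ^ j := by
    rw [Int.negOnePow_def, zpow_natCast, Units.val_pow_eq_pow_val, Units.val_neg, Units.val_one]
  have hs : (((j : ℤ) + 1).negOnePow : ℤ) = -(-1) ^ j := by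
    rw [Int.negOnePow_succ, Units.val_neg, hs0]
  have hs' : ((-(j : ℤ)).negOnePow : ℤ) = (-1) ^ j := by
    rw [Int.negOnePow_neg, hs0]
  have e1 : (n : ℤ) - 3 * -(j : ℤ) * (3 * -(j : ℤ) - 1) =
      n - ((6 * ((j + 1).choose 2 + j ^ 2) : ℕ) : ℤ) := by
    push_cast; linear_combination 3 * ht
  have e2 : (n : ℤ) - 3 * ((j : ℤ) + 1) * (3 * ((j : ℤ) + 1) - 1) =
      n - ((6 * ((j + 1).choose 2 + j ^ 2 + (2 * j + 1)) : ℕ) : ℤ) := by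
    push_cast; linear_combination 3 * ht
  have hc : ∀ a b : ℤ⟦X⟧, coeff n (a * ((-1) ^ j * b)) = (-1) ^ j * coeff n (a * b) := fun a b => by
    rw [show a * ((-1) ^ j * b) = C ((-1) ^ j) * (a * b) by simp; ring, coeff_C_mul]
  rw [hs, hs', e1, e2, partitionCount_sub, partitionCount_sub, map_mul expandSix,
    map_sub expandSix, hX, hX, map_pow expandSix, map_neg expandSix, map_one, hc, mul_sub, map_sub]
  ring

theorem coeff_mul_expandSix (f g : ℤ⟦X⟧) (n : ℕ) : coeff n (f * expandSix g) =
    ∑ j ∈ Finset.range (n / 6 + 1), coeff (n - 6 * j) f * coeff j g := by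
  rw [mul_comm, coeff_mul, Finset.Nat.sum_antidiagonal_eq_sum_range_succ
    (fun i j => coeff i (expandSix g) * coeff j f)]
  symm
  refine Finset.sum_of_injOn (6 * ·) (mul_right_injective₀ (by norm_num : (6 : ℕ) ≠ 0)).injOn
    ?_ ?_ ?_
  · intro j hj
    simp only [Finset.coe_range, Set.mem_Iio] at hj ⊢
    omega
  · intro i hi hi'
    rw [expandSix, coeff_expand, if_neg, zero_mul]
    rintro ⟨j, rfl⟩
    refine hi' ⟨j, ?_, rfl⟩
    simp only [Finset.coe_range, Set.mem_Iio, Finset.mem_range] at hi ⊢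
    omega
  · intro j _
    rw [expandSix, coeff_expand_mul, mul_comm]

theorem mainTheorem5 (n k : ℕ) (hk : 0 < k) :
    (-1 : ℤ) ^ k * ((sixRegularCount n : ℤ) -
        ∑ j ∈ Finset.Icc (-((k : ℤ) - 1)) (k : ℤ),
          (j.negOnePow : ℤ) * (partitionCount ((n : ℤ) - 3 * j * (3 * j - 1)) : ℤ)) =
      ∑ j ∈ Finset.range (n / 6 + 1), (sixRegularCount (n - 6 * j) : ℤ) * (andrewsMerca k j : ℤ) := by
  obtain ⟨k, rfl⟩ := Nat.exists_eq_succ_of_ne_zero hk.ne'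
  rw [Nat.succ_eq_add_one]
  simp only [sixRegularCount_eq_coeff, andrewsMerca_eq_coeff]
  rw [sum_partitionCount_eq_coeff, ← coeff_mul_expandSix, sumSeries_partsAbove_zero_eq_mul,
    mul_assoc, ← map_mul, sumSeries_partsAbove_mul_pentagonalTrunc, map_add expandSix,
    map_mul expandSix, map_pow expandSix, map_neg expandSix, map_one, mul_add, mul_one, map_add]
  generalize sumSeries {s | 0 ∉ s ∧ ∀ i ∈ s, ¬ 6 ∣ i} = f
  generalize expandSix (sumSeries (mexParts k)) = g
  have hc : coeff n (f * ((-1) ^ k * g)) = (-1) ^ k * coeff n (f * g) := by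
    rw [show f * ((-1) ^ k * g) = C ((-1) ^ k) * (f * g) by simp; ring, coeff_C_mul]
  rw [hc, pow_succ]
  have : (-1 : ℤ) ^ k * (-1) ^ k = 1 := by rw [← mul_pow]; simp
  linear_combination coeff n (f * g) * this
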